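/- A (distributive) p-algebra is a bounded distributive lattice with a unary operation ${}^*$ satisfying $x\wedge y=0\iff x\le y^*$. For $n\in\mathbb{N}$ let $\overline{B}_n$ be the p-algebra obtained from the Boolean algebra with $n$ atoms by adding a new top element (so $\overline{B}_0$ is the two-element Boolean algebra), and let $\mathrm{Pa}_n$ be the variety generated by $\overline{B}_n$; let $\mathrm{Pa}_\omega$ be the variety of all p-algebras. For $n\in\mathbb{N}\cup\{\omega\}$ and $k\in\mathbb{N}$ let $F_n(k)$ be the free algebra in $\mathrm{Pa}_n$ on free generators $x_1,\dots,x_k$ (its elements are the p-algebra terms in $x_1,\dots,x_k$ modulo the identities of $\mathrm{Pa}_n$), and let $J(F_n(k))$ be the set of its join-irreducible elements ($0$ is not join-irreducible). For $T\subseteq\{1,\dots,k\}$, for a set $\mathcal{T}$ of subsets of $\{1,\dots,k\}$, and for $L\subseteq\{1,\dots,k\}$ put $$x_T=\bigwedge_{i\in T}x_i\wedge\bigwedge_{i\notin T}x_i^*,\qquad p^L_{\mathcal{T}}=\Bigl(\bigvee_{T\in\mathcal{T}}x_T\Bigr)^{**}\wedge\bigwedge_{i\in L}x_i .$$ **Theorem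 (Normal form theorem).** Let $n\in\mathbb{N}\cup\{\omega\}$, $k\in\mathbb{N}$ and $t\in F_n(k)$. Let $S_t$ be the set of all $p^L_{\mathcal{T}}\in J(F_n(k))$ with $p^L_{\mathcal{T}}\le t$, where $\mathcal{T}$ ranges over the sets of subsets of $\{1,\dots,k\}$ with $0<|\mathcal{T}|\le\max(n,1)$, and $L$ over the subsets of $\bigcap\mathcal{T}$. Then $$t=\bigvee S_t\qquad\text{and also}\qquad t=\bigvee\max S_t ,$$ where $\max S_t$ is the set of maximal elements of $S_t$ (and the empty join is $0$). -/

import Mathlib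

universe u v

/-- A (distributive) p-algebra: a bounded distributive lattice with a unary operation `ᶜ`
(written `*` on paper) such that `a ∧ b = 0 ↔ a ≤ b*`. -/
class PAlgebra (A : Type u) extends DistribLattice A, BoundedOrder A, Compl A where
  inf_eq_bot_iff_le_compl : ∀ a b : A, a ⊓ b = ⊥ ↔ a ≤ bᶜ

/-- Terms in the signature `(∧, ∨, *, 0, 1)` of p-algebras, with variables from `X`. -/
inductive PTerm (X : Type u) : Type u
  | var : X → PTerm X
  | bot : PTerm X
  | top : PTerm X
  | inf : PTerm X → PTerm X → PTerm X
  | sup : PTerm X → PTerm X → PTerm X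
  | compl : PTerm X → PTerm X

namespace PTerm

/-- The value of a term in a p-algebra under a valuation of the variables. -/
def eval {X : Type u} {A : Type v} [PAlgebra A] (w : X → A) : PTerm X → A
  | var i => w i
  | bot => ⊥
  | top => ⊤
  | inf s t => s.eval w ⊓ t.eval w
  | sup s t => s.eval w ⊔ t.eval w
  | compl s => (s.eval w)ᶜ

end PTerm

/-- The finite subdirectly irreducible p-algebra with `n` atoms: the Boolean algebra with `n`
atoms, with a new top element added. -/
def BoolTop (n : ℕ) : Type := WithTop (Finset (Fin n))

namespace BoolTop

instance (n : ℕ) : DistribLattice (BoolTop n) :=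
  inferInstanceAs (DistribLattice (WithTop (Finset (Fin n))))

instance (n : ℕ) : BoundedOrder (BoolTop n) :=
  inferInstanceAs (BoundedOrder (WithTop (Finset (Fin n))))

/-- Pseudo-complementation: `1* = 0`, `0* = 1`, and `b* = ¬ b` for every other `b`. -/
def pcompl {n : ℕ} : WithTop (Finset (Fin n)) → WithTop (Finset (Fin n))
  | none => ⊥
  | some b => if b = ∅ then ⊤ else ((bᶜ : Finset (Fin n)) : WithTop (Finset (Fin n)))

theorem pcompl_spec {n : ℕ} (a b : WithTop (Finset (Fin n))) :
    a ⊓ b = ⊥ ↔ a ≤ pcompl b := by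
  induction b with
  | top =>
    have h : pcompl (⊤ : WithTop (Finset (Fin n))) = ⊥ := rfl
    rw [h, inf_top_eq, le_bot_iff]
  | coe b =>
    have h : pcompl (b : WithTop (Finset (Fin n))) =
      if b = ∅ then ⊤ else ((bᶜ : Finset (Fin n)) : WithTop (Finset (Fin n))) := rfl
    rw [h]
    by_cases hb : b = ∅
    · subst hb
      have h0 : ((∅ : Finset (Fin n)) : WithTop (Finset (Fin n))) = ⊥ := rfl
      simp [h0]
    · rw [if_neg hb]
      induction a with
      | top =>
        simp only [top_inf_eq, top_le_iff, WithTop.coe_ne_top, iff_false]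
        rw [← WithTop.coe_bot, WithTop.coe_inj]
        exact hb
      | coe a =>
        rw [← WithTop.coe_inf, ← WithTop.coe_bot, WithTop.coe_inj, WithTop.coe_le_coe,
          le_compl_iff_disjoint_right, disjoint_iff]

instance (n : ℕ) : PAlgebra (BoolTop n) where
  compl := pcompl
  inf_eq_bot_iff_le_compl := pcompl_spec

end BoolTop

/-- Membership of a p-algebra in the variety `Pa_n`. For `n ∈ ℕ` this is the variety generated by
`BoolTop n`, i.e. the class of p-algebras satisfying all identities that hold in `BoolTop n`;
`Pa_⊤` is the variety of all p-algebras. -/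
def InPa (n : ℕ∞) (A : Type u) [PAlgebra A] : Prop :=
  ∀ N : ℕ, n = N → ∀ (m : ℕ) (s t : PTerm (Fin m)),
    (∀ w : Fin m → BoolTop N, s.eval w = t.eval w) → ∀ w : Fin m → A, s.eval w = t.eval w

/-- Two terms in `k` variables are identified if they have equal values under all valuations in
all members of `Pa_n`. -/
def paSetoid (n : ℕ∞) (k : ℕ) : Setoid (PTerm (Fin k)) where
  r s t := ∀ (A : Type) [PAlgebra A], InPa n A → ∀ w : Fin k → A, s.eval w = t.eval w
  iseqv :=
    ⟨fun _ _ _ _ _ => rfl, fun h A _ hA w => (h A hA w).symm,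
      fun h h' A _ hA w => (h A hA w).trans (h' A hA w)⟩

/-- The free algebra `F_n(k)` in `Pa_n` on `k` free generators: terms in `k` variables modulo the
identities of `Pa_n`. -/
def FreePa (n : ℕ∞) (k : ℕ) : Type := Quotient (paSetoid n k)

namespace FreePa

variable {n : ℕ∞} {k : ℕ}

/-- The class of a term. -/
def mk (t : PTerm (Fin k)) : FreePa n k := Quotient.mk (paSetoid n k) t

/-- The free generators `x_i`. -/
def gen (i : Fin k) : FreePa n k := mk (PTerm.var i)

/-- The map `F_n(k) → A`, for `A` in `Pa_n`, that extends `gen i ↦ w i`. -/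
def lift {A : Type} [PAlgebra A] (hA : InPa n A) (w : Fin k → A) : FreePa n k → A :=
  Quotient.lift (fun t => t.eval w) fun _ _ h => h A hA w

theorem lift_mk {A : Type} [PAlgebra A] (hA : InPa n A) (w : Fin k → A) (t : PTerm (Fin k)) :
    lift hA w (mk t) = t.eval w := rfl

theorem mk_eq_iff {s t : PTerm (Fin k)} : (mk s : FreePa n k) = mk t ↔
    ∀ (A : Type) [PAlgebra A], InPa n A → ∀ w : Fin k → A, s.eval w = t.eval w :=
  ⟨fun h => Quotient.exact h, fun h => Quotient.sound h⟩

theorem ind {P : FreePa n k → Prop} (h : ∀ t, P (mk t)) (a : FreePa n k) : P a :=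
  Quotient.ind h a

/-- The meet, computed on terms. -/
def meet : FreePa n k → FreePa n k → FreePa n k :=
  Quotient.map₂ PTerm.inf fun _ _ h _ _ h' A _ hA w =>
    congrArg₂ (· ⊓ ·) (h A hA w) (h' A hA w)

/-- The join, computed on terms. -/
def join : FreePa n k → FreePa n k → FreePa n k :=
  Quotient.map₂ PTerm.sup fun _ _ h _ _ h' A _ hA w =>
    congrArg₂ (· ⊔ ·) (h A hA w) (h' A hA w)

/-- The pseudo-complement, computed on terms. -/
def pcompl : FreePa n k → FreePa n k :=
  Quotient.map PTerm.compl fun _ _ h A _ hA w => congrArg compl (h A hA w)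

/-- The lattice structure, with `a ≤ b ↔ a ∨ b = b`. -/
instance : Lattice (FreePa n k) :=
  @Lattice.mk' (FreePa n k) ⟨join⟩ ⟨meet⟩
    (fun a b => by
      induction a using ind; induction b using ind
      exact mk_eq_iff.2 fun _ _ _ _ => sup_comm _ _)
    (fun a b c => by
      induction a using ind; induction b using ind; induction c using ind
      exact mk_eq_iff.2 fun _ _ _ _ => sup_assoc _ _ _)
    (fun a b => by
      induction a using ind; induction b using ind
      exact mk_eq_iff.2 fun _ _ _ _ => inf_comm _ _)
    (fun a b c => by
      induction a using ind; induction b using ind; induction c using ind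
      exact mk_eq_iff.2 fun _ _ _ _ => inf_assoc _ _ _)
    (fun a b => by
      induction a using ind; induction b using ind
      exact mk_eq_iff.2 fun _ _ _ _ => sup_inf_self)
    (fun a b => by
      induction a using ind; induction b using ind
      exact mk_eq_iff.2 fun _ _ _ _ => inf_sup_self)

theorem mk_inf (s t : PTerm (Fin k)) : (mk s ⊓ mk t : FreePa n k) = mk (s.inf t) := rfl

theorem mk_sup (s t : PTerm (Fin k)) : (mk s ⊔ mk t : FreePa n k) = mk (s.sup t) := rfl

theorem mk_le_iff {s t : PTerm (Fin k)} : (mk s : FreePa n k) ≤ mk t ↔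
    ∀ (A : Type) [PAlgebra A], InPa n A → ∀ w : Fin k → A, s.eval w ≤ t.eval w := by
  rw [← sup_eq_right, mk_sup, mk_eq_iff]
  exact forall_congr' fun _ => forall_congr' fun _ => forall_congr' fun _ =>
    forall_congr' fun _ => sup_eq_right

instance : PAlgebra (FreePa n k) where
  compl := pcompl
  le_sup_inf a b c := by
    induction a using ind; induction b using ind; induction c using ind
    exact mk_le_iff.2 fun _ _ _ _ => le_sup_inf
  top := mk PTerm.top
  le_top a := by
    induction a using ind
    exact mk_le_iff.2 fun _ _ _ _ => le_top
  bot := mk PTerm.bot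
  bot_le a := by
    induction a using ind
    exact mk_le_iff.2 fun _ _ _ _ => bot_le
  inf_eq_bot_iff_le_compl a b := by
    induction a using ind; induction b using ind
    refine (mk_eq_iff (s := PTerm.inf _ _) (t := PTerm.bot)).trans
      (Iff.trans ?_ (mk_le_iff (t := PTerm.compl _)).symm)
    exact forall_congr' fun _ => forall_congr' fun _ => forall_congr' fun _ =>
      forall_congr' fun _ => PAlgebra.inf_eq_bot_iff_le_compl _ _

theorem mk_compl (s : PTerm (Fin k)) : ((mk s)ᶜ : FreePa n k) = mk s.compl := rfl

/-- Every element of `F_n(k)` is the value of a term at the free generators. -/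
theorem eval_gen (t : PTerm (Fin k)) : t.eval (gen : Fin k → FreePa n k) = mk t := by
  induction t with
  | var i => rfl
  | bot => rfl
  | top => rfl
  | inf s t hs ht => rw [PTerm.eval, hs, ht, mk_inf]
  | sup s t hs ht => rw [PTerm.eval, hs, ht, mk_sup]
  | compl s hs => rw [PTerm.eval, hs, mk_compl]

/-- `F_n(k)` belongs to `Pa_n`. -/
theorem inPa : InPa n (FreePa n k) := by
  intro N hN m s t hst w
  choose r hr using fun i => Quotient.exists_rep (w i)
  have key : ∀ q : PTerm (Fin m), ∃ q' : PTerm (Fin k), q.eval w = mk q' ∧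
      ∀ (A : Type) [PAlgebra A] (z : Fin k → A),
        q'.eval z = q.eval fun i => (r i).eval z := by
    intro q
    induction q with
    | var i => exact ⟨r i, (hr i).symm, fun _ _ _ => rfl⟩
    | bot => exact ⟨.bot, rfl, fun _ _ _ => rfl⟩
    | top => exact ⟨.top, rfl, fun _ _ _ => rfl⟩
    | inf s t hs ht =>
      obtain ⟨s', h1, h2⟩ := hs
      obtain ⟨t', h3, h4⟩ := ht
      exact ⟨s'.inf t', by rw [PTerm.eval, h1, h3, mk_inf],
        fun A _ z => by rw [PTerm.eval, PTerm.eval, h2, h4]⟩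
    | sup s t hs ht =>
      obtain ⟨s', h1, h2⟩ := hs
      obtain ⟨t', h3, h4⟩ := ht
      exact ⟨s'.sup t', by rw [PTerm.eval, h1, h3, mk_sup],
        fun A _ z => by rw [PTerm.eval, PTerm.eval, h2, h4]⟩
    | compl s hs =>
      obtain ⟨s', h1, h2⟩ := hs
      exact ⟨s'.compl, by rw [PTerm.eval, h1, mk_compl],
        fun A _ z => by rw [PTerm.eval, PTerm.eval, h2]⟩
  obtain ⟨s', h1, h2⟩ := key s
  obtain ⟨t', h3, h4⟩ := key t
  rw [h1, h3, mk_eq_iff]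
  intro A _ hA z
  rw [h2, h4]
  exact hA N hN m s t hst _

/-- `x_T = ⋀_{i ∈ T} x_i ∧ ⋀_{i ∉ T} x_i*`. -/
def xT (n : ℕ∞) {k : ℕ} (T : Finset (Fin k)) : FreePa n k :=
  T.inf gen ⊓ Tᶜ.inf fun i => (gen i)ᶜ

/-- `p^L_𝒯 = (⋁_{T ∈ 𝒯} x_T)** ∧ ⋀_{i ∈ L} x_i`. -/
def pLT (n : ℕ∞) {k : ℕ} (L : Finset (Fin k)) (𝒯 : Finset (Finset (Fin k))) : FreePa n k :=
  (𝒯.sup (xT n))ᶜᶜ ⊓ L.inf gen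

/-- The set of those join-irreducible elements of `F_n(k)` below `t` that have the form `p^L_𝒯`
with `𝒯` a nonempty set of at most `max n 1` subsets of `{1, …, k}` and `L ⊆ ⋂ 𝒯`. -/
def irredTermsBelow (t : FreePa n k) : Set (FreePa n k) :=
  {p | SupIrred p ∧ p ≤ t ∧ ∃ (L : Finset (Fin k)) (𝒯 : Finset (Finset (Fin k))),
    𝒯.Nonempty ∧ (𝒯.card : ℕ∞) ≤ max n 1 ∧ (∀ T ∈ 𝒯, L ⊆ T) ∧ p = pLT n L 𝒯}

end FreePa

/-!
It has to be shown that `t ≰ u` in `F_n(k)` implies `p ≤ t` and `p ≰ u` for some `p` among the join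
irreducibles `p^L_𝒯`. The prime ideal theorem for distributive lattices gives a prime ideal `I`
that contains `u` but not `t`; let `P` be the complementary prime filter. Put
`L = {i | x_i ∈ P}` and `𝒯 = {T | x_T* ∉ P}`. Then `P` is the principal filter generated by
`p = p^L_𝒯`, so that `p` is join prime with `p ≤ t` and `p ≰ u`.

Two facts about the elements `x_T` carry this. An element disjoint from every `x_T` is zero
(`FreePa.eq_bot_of_forall_inf_xT`), and every element `a` of `F_n(k)` satisfies `x_T ≤ a` or
`x_T ≤ a*` (`FreePa.xT_le_or_le_compl`). The first gives `p ∈ P`. By the second, induction on terms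
gives `p ≤ a` for every `a ∈ P`.

For the bound on `|𝒯|`, note that more than `max N 1` pairwise disjoint elements of `BoolTop N`
cannot all be nonzero. Hence `⋁_{T ∈ 𝒮} x_T* = 1` holds in `F_N(k)` whenever `|𝒮| > max N 1`
(`FreePa.sup_compl_xT_eq_top`), and since `P` is prime, some `x_T*` with `T ∈ 𝒮` belongs to `P`.

As there are only finitely many `p^L_𝒯`, each one below `t` lies below a maximal one, and the
second join equals the first.
-/

/-! ### Pseudo-complements -/

namespace PAlgebra

variable {A : Type u} [PAlgebra A] {a b : A}

theorem le_compl_iff : a ≤ bᶜ ↔ a ⊓ b = ⊥ := (inf_eq_bot_iff_le_compl a b).symm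

theorem le_compl_comm : a ≤ bᶜ ↔ b ≤ aᶜ := by
  rw [le_compl_iff, le_compl_iff, inf_comm]

theorem inf_compl_self (a : A) : a ⊓ aᶜ = ⊥ := by
  rw [inf_comm, ← le_compl_iff]

theorem le_compl_compl (a : A) : a ≤ aᶜᶜ := le_compl_comm.1 le_rfl

theorem compl_anti (h : a ≤ b) : bᶜ ≤ aᶜ := le_compl_comm.1 (h.trans (le_compl_compl b))

theorem compl_bot : (⊥ᶜ : A) = ⊤ := top_le_iff.1 (le_compl_iff.2 (by simp))

theorem compl_top : (⊤ᶜ : A) = ⊥ := by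
  simpa using inf_compl_self (⊤ : A)

theorem eq_bot_of_inf_of_inf_compl (h : a ⊓ b = ⊥) (h' : a ⊓ bᶜ = ⊥) : a = ⊥ := by
  rwa [inf_eq_left.2 (le_compl_iff.2 h)] at h'

/-- An element disjoint from every conjunction that contains, for each `i ∈ S`, one of `f i` and
`(f i)ᶜ`, is zero. -/
theorem eq_bot_of_forall_subset_inf {ι : Type*} [DecidableEq ι] (f : ι → A) (S : Finset ι)
    (h : ∀ T ⊆ S, a ⊓ (T.inf f ⊓ (S \ T).inf fun i => (f i)ᶜ) = ⊥) : a = ⊥ := by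
  induction S using Finset.induction_on with
  | empty => simpa using h ∅ le_rfl
  | insert i S hi ih =>
    refine ih fun T hT => eq_bot_of_inf_of_inf_compl (b := f i) ?_ ?_
    · have h1 := h (insert i T) (Finset.insert_subset_insert i hT)
      have h2 : insert i S \ insert i T = S \ T := by
        ext j; simp only [Finset.mem_sdiff, Finset.mem_insert]; grind
      rw [h2, Finset.inf_insert] at h1
      rw [← h1]; ac_rfl
    · have h1 := h T (hT.trans (Finset.subset_insert i S))
      have h2 : insert i S \ T = insert i (S \ T) := by
        ext j; simp only [Finset.mem_sdiff, Finset.mem_insert]; grind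
      rw [h2, Finset.inf_insert] at h1
      rw [← h1]; ac_rfl

end PAlgebra

namespace BoolTop

/-- If more than `max N 1` elements of `BoolTop N` are pairwise disjoint, then one of them is zero,
so that the join of their pseudo-complements is one. -/
theorem sup_compl_eq_top {N : ℕ} {ι : Type*} (s : Finset ι) (f : ι → BoolTop N)
    (hf : ∀ i ∈ s, ∀ j ∈ s, i ≠ j → f i ⊓ f j = ⊥) (hs : max N 1 < s.card) :
    (s.sup fun i => (f i)ᶜ) = ⊤ := by
  by_contra hne
  have h0 : ∀ i ∈ s, f i ≠ ⊥ := fun i hi h => hne <| top_le_iff.1 <| by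
    have h1 := Finset.le_sup (f := fun i => (f i)ᶜ) hi
    simpa only [h, PAlgebra.compl_bot] using h1
  have hN : N < s.card := (le_max_left N 1).trans_lt hs
  -- With two elements at least, each of them has a nonzero element disjoint from it.
  have h1 : ∀ i ∈ s, f i ≠ ⊤ := fun i hi h => by
    obtain ⟨j, hj, hji⟩ := Finset.exists_mem_ne ((le_max_right N 1).trans_lt hs) i
    have h2 := hf i hi j hj hji.symm
    rw [h, top_inf_eq] at h2
    exact h0 j hj h2
  have h2 : ∀ i ∈ s, ∃ x : Fin N, ∃ b : Finset (Fin N),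
      (b : WithTop (Finset (Fin N))) = f i ∧ x ∈ b := fun i hi => by
    obtain ⟨b, hb⟩ := WithTop.ne_top_iff_exists.1 (h1 i hi)
    have hb0 : b ≠ ∅ := fun h => h0 i hi (by rw [← hb, h]; rfl)
    obtain ⟨x, hx⟩ := Finset.nonempty_iff_ne_empty.2 hb0
    exact ⟨x, b, hb, hx⟩
  obtain ⟨i₀, hi₀⟩ := Finset.card_pos.1 ((Nat.zero_le N).trans_lt hN)
  have : Nonempty (Fin N) := ⟨(h2 i₀ hi₀).choose⟩
  choose! g b hb hg using h2
  have hinj : Set.InjOn g s := fun i hi j hj hij => by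
    by_contra hne'
    have h3 : ((b i : WithTop (Finset (Fin N))) ⊓ (b j : WithTop (Finset (Fin N)))) = ⊥ := by
      have := hf i hi j hj hne'
      rw [← hb i hi, ← hb j hj] at this
      exact this
    rw [← WithTop.coe_inf, ← WithTop.coe_bot, WithTop.coe_inj] at h3
    have h4 : g i ∈ b i ⊓ b j := Finset.mem_inter.2 ⟨hg i hi, hij ▸ hg j hj⟩
    rw [h3] at h4
    exact Finset.notMem_empty _ h4
  have h3 := Finset.card_le_card_of_injOn (t := Finset.univ) g (fun _ _ => Finset.mem_univ _) hinj
  rw [Finset.card_fin] at h3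
  omega

theorem inPa (N : ℕ) : InPa N (BoolTop N) := by
  intro M hM m s t h w
  obtain rfl : N = M := by exact_mod_cast hM
  exact h w

end BoolTop

/-! ### The elements `x_T` -/

namespace FreePa

open PAlgebra

variable {n : ℕ∞} {k : ℕ}

theorem xT_le_gen {T : Finset (Fin k)} {i : Fin k} (h : i ∈ T) : xT n T ≤ gen i :=
  inf_le_left.trans (Finset.inf_le h)

theorem xT_le_compl_gen {T : Finset (Fin k)} {i : Fin k} (h : i ∉ T) : xT n T ≤ (gen i)ᶜ :=
  inf_le_right.trans (Finset.inf_le (f := fun i => (gen i)ᶜ) (Finset.mem_compl.2 h))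

theorem inf_xT_eq_bot {S T : Finset (Fin k)} (h : S ≠ T) : xT n S ⊓ xT n T = ⊥ := by
  obtain ⟨i, hi⟩ : ∃ i, ¬ (i ∈ S ↔ i ∈ T) := by
    by_contra! h'
    exact h (Finset.ext h')
  rw [← le_bot_iff, ← inf_compl_self (gen i : FreePa n k)]
  by_cases hS : i ∈ S
  · exact inf_le_inf (xT_le_gen hS) (xT_le_compl_gen (by tauto))
  · rw [inf_comm]
    exact inf_le_inf (xT_le_gen (by tauto)) (xT_le_compl_gen hS)

theorem eq_bot_of_forall_inf_xT {a : FreePa n k} (h : ∀ T, a ⊓ xT n T = ⊥) : a = ⊥ := by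
  refine eq_bot_of_forall_subset_inf gen Finset.univ fun T _ => ?_
  rw [← Finset.compl_eq_univ_sdiff]
  exact h T

theorem xT_le_or_le_compl (T : Finset (Fin k)) (a : FreePa n k) : xT n T ≤ a ∨ xT n T ≤ aᶜ := by
  induction a using ind with | _ s =>
  induction s with
  | var i =>
    by_cases hi : i ∈ T
    · exact .inl (xT_le_gen hi)
    · exact .inr (xT_le_compl_gen hi)
  | bot => exact .inr (le_top.trans_eq PAlgebra.compl_bot.symm)
  | top => exact .inl le_top
  | inf s t hs ht =>
    rw [← mk_inf]
    rcases hs with hs | hs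
    · exact ht.imp (le_inf hs) fun ht => ht.trans (compl_anti inf_le_right)
    · exact .inr (hs.trans (compl_anti inf_le_left))
  | sup s t hs ht =>
    rw [← mk_sup]
    rcases hs with hs | hs
    · exact .inl (hs.trans le_sup_left)
    · refine ht.imp (fun ht => ht.trans le_sup_right) fun ht => ?_
      exact le_compl_comm.1 (sup_le (le_compl_comm.1 hs) (le_compl_comm.1 ht))
  | compl s hs =>
    rw [← mk_compl]
    exact hs.symm.imp_right fun hs => hs.trans (le_compl_compl _)

/-- The extension of a valuation to `F_n(k)`, as a homomorphism of bounded lattices. -/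
def liftHom {A : Type} [PAlgebra A] (hA : InPa n A) (w : Fin k → A) :
    BoundedLatticeHom (FreePa n k) A where
  toFun := lift hA w
  map_sup' a b := by induction a using ind; induction b using ind; rfl
  map_inf' a b := by induction a using ind; induction b using ind; rfl
  map_top' := rfl
  map_bot' := rfl

theorem liftHom_compl {A : Type} [PAlgebra A] (hA : InPa n A) (w : Fin k → A) (a : FreePa n k) :
    liftHom hA w aᶜ = (liftHom hA w a)ᶜ := by
  induction a using ind; rfl

/-- Elements of `F_N(k)` are separated by the homomorphisms to `BoolTop N`. -/
theorem eq_of_forall_liftHom_eq {N : ℕ} {a b : FreePa N k}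
    (h : ∀ w : Fin k → BoolTop N,
      liftHom (BoolTop.inPa N) w a = liftHom (BoolTop.inPa N) w b) : a = b := by
  induction a using ind; induction b using ind
  exact mk_eq_iff.2 fun A _ hA w => hA N rfl k _ _ h w

theorem sup_compl_xT_eq_top {N : ℕ} (𝒮 : Finset (Finset (Fin k))) (h : max N 1 < 𝒮.card) :
    (𝒮.sup fun T => (xT N T)ᶜ) = ⊤ := by
  refine eq_of_forall_liftHom_eq fun w => ?_
  rw [map_finset_sup, map_top]
  have h1 : ⇑(liftHom (BoolTop.inPa N) w) ∘ (fun T => (xT N T)ᶜ) =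
      fun T => (liftHom (BoolTop.inPa N) w (xT N T))ᶜ := funext fun T => liftHom_compl _ _ _
  rw [h1]
  refine BoolTop.sup_compl_eq_top 𝒮 _ (fun S _ T _ hST => ?_) h
  rw [← map_inf, inf_xT_eq_bot hST, map_bot]

/-! ### Prime filters are generated by elements `p^L_𝒯` -/

open Order

theorem _root_.Order.Ideal.IsPrime.finset_inf_notMem {A ι : Type*} [Lattice A] [BoundedOrder A]
    {I : Ideal A} (hI : I.IsPrime) {s : Finset ι} {f : ι → A} (h : ∀ i ∈ s, f i ∉ I) :
    s.inf f ∉ I :=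
  Finset.inf_induction (p := (· ∉ I)) (hI.top_notMem)
    (fun _ ha _ hb hab => (hI.mem_or_mem hab).elim ha hb) h

open Classical in
/-- The set `L = {i | x_i ∉ I}` attached to an ideal `I`. -/
noncomputable def gensOutside (I : Ideal (FreePa n k)) : Finset (Fin k) := {i | gen i ∉ I}

open Classical in
/-- The set `𝒯 = {T | x_T* ∈ I}` attached to an ideal `I`. -/
noncomputable def atomsOver (I : Ideal (FreePa n k)) : Finset (Finset (Fin k)) := {T | (xT n T)ᶜ ∈ I}

theorem mem_gensOutside {I : Ideal (FreePa n k)} {i : Fin k} :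
    i ∈ gensOutside I ↔ gen i ∉ I := by simp [gensOutside]

theorem mem_atomsOver {I : Ideal (FreePa n k)} {T : Finset (Fin k)} :
    T ∈ atomsOver I ↔ (xT n T)ᶜ ∈ I := by simp [atomsOver]

variable {I : Ideal (FreePa n k)}

theorem gensOutside_subset {T : Finset (Fin k)} (hT : T ∈ atomsOver I) : gensOutside I ⊆ T := by
  intro i hi
  by_contra hiT
  exact mem_gensOutside.1 hi
    (I.lower (le_compl_comm.1 (xT_le_compl_gen hiT)) (mem_atomsOver.1 hT))

theorem card_atomsOver_le (hI : I.IsPrime) : ((atomsOver I).card : ℕ∞) ≤ max n 1 := by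
  induction n with
  | top => simp
  | coe N =>
    by_contra! h
    have h' : max N 1 < (atomsOver I).card :=
      max_lt (by exact_mod_cast (le_max_left _ _).trans_lt h)
        (by exact_mod_cast (le_max_right _ _).trans_lt h)
    refine hI.top_notMem ?_
    rw [← sup_compl_xT_eq_top _ h']
    exact Finset.sup_induction I.bot_mem (fun _ ha _ hb => I.sup_mem ha hb)
      fun T hT => mem_atomsOver.1 hT

/-- The prime filter complementary to `I` contains the meet of the `x_T*` with `T ∉ 𝒯`; under `h`
this meet is disjoint from `a`. -/
theorem compl_notMem (hI : I.IsPrime) {a : FreePa n k} (h : ∀ T ∈ atomsOver I, xT n T ≤ aᶜ) :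
    aᶜ ∉ I := by
  have h1 : ((atomsOver I)ᶜ.inf fun T => (xT n T)ᶜ) ∉ I :=
    hI.finset_inf_notMem fun T hT => by rwa [Finset.mem_compl, mem_atomsOver] at hT
  refine fun ha => h1 (I.lower (le_compl_iff.2 (eq_bot_of_forall_inf_xT fun T => ?_)) ha)
  rw [← le_bot_iff]
  by_cases hT : T ∈ atomsOver I
  · rw [← inf_compl_self a]
    exact inf_le_inf inf_le_right (h T hT)
  · rw [← inf_compl_self (xT n T), inf_comm]
    exact inf_le_inf le_rfl (inf_le_left.trans
      (Finset.inf_le (f := fun T => (xT n T)ᶜ) (Finset.mem_compl.2 hT)))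

theorem pLT_notMem (hI : I.IsPrime) : pLT n (gensOutside I) (atomsOver I) ∉ I := by
  refine fun h => (hI.mem_or_mem h).elim (compl_notMem hI fun T hT => ?_)
    (hI.finset_inf_notMem fun i hi => mem_gensOutside.1 hi)
  exact (Finset.le_sup hT).trans (le_compl_compl _)

theorem atomsOver_nonempty (hI : I.IsPrime) : (atomsOver I).Nonempty := by
  by_contra h
  refine pLT_notMem hI ?_
  rw [Finset.not_nonempty_iff_eq_empty.1 h, pLT, Finset.sup_empty,
    PAlgebra.compl_bot, PAlgebra.compl_top, bot_inf_eq]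
  exact I.bot_mem

theorem pLT_le {a : FreePa n k} (ha : a ∉ I) :
    pLT n (gensOutside I) (atomsOver I) ≤ a := by
  induction a using ind with | _ s =>
  induction s with
  | var i => exact inf_le_right.trans (Finset.inf_le (mem_gensOutside.2 ha))
  | bot => exact absurd I.bot_mem ha
  | top => exact le_top
  | inf s t hs ht =>
    rw [← mk_inf] at ha ⊢
    exact le_inf (hs fun h => ha (I.lower inf_le_left h)) (ht fun h => ha (I.lower inf_le_right h))
  | sup s t hs ht =>
    rw [← mk_sup] at ha ⊢
    by_cases h : mk s ∈ I
    · exact (ht fun h' => ha (I.sup_mem h h')).trans le_sup_right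
    · exact (hs h).trans le_sup_left
  | compl s _ =>
    rw [← mk_compl] at ha ⊢
    have h1 : (atomsOver I).sup (xT n) ≤ (mk s)ᶜ := Finset.sup_le fun T hT =>
      (xT_le_or_le_compl T (mk s)).resolve_left fun h =>
        ha (I.lower (compl_anti h) (mem_atomsOver.1 hT))
    -- `(⋁ x_T)** ≤ s*** = s*`
    exact inf_le_left.trans (le_compl_comm.1 ((le_compl_comm.1 h1).trans (le_compl_compl _)))

/-- The filter complementary to a prime ideal is principal, generated by `p^L_𝒯`. -/
theorem pLT_le_iff (hI : I.IsPrime) {a : FreePa n k} :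
    pLT n (gensOutside I) (atomsOver I) ≤ a ↔ a ∉ I :=
  ⟨fun h ha => pLT_notMem hI (I.lower h ha), pLT_le⟩

theorem supPrime_pLT (hI : I.IsPrime) : SupPrime (pLT n (gensOutside I) (atomsOver I)) := by
  refine ⟨fun h => pLT_notMem hI (h.eq_bot ▸ I.bot_mem), fun a b h => ?_⟩
  rw [pLT_le_iff hI] at h ⊢
  rw [pLT_le_iff hI]
  by_contra! h'
  exact h (I.sup_mem h'.1 h'.2)

/-! ### The normal form -/

theorem exists_mem_irredTermsBelow_not_le {t u : FreePa n k} (h : ¬ t ≤ u) :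
    ∃ p ∈ irredTermsBelow t, ¬ p ≤ u := by
  obtain ⟨I, hI, hu, ht⟩ := DistribLattice.prime_ideal_of_disjoint_filter_ideal
    (F := PFilter.principal t) (I := Ideal.principal u)
    (Set.disjoint_left.2 fun x hx hx' => h
      ((PFilter.mem_principal.1 hx).trans (Ideal.mem_principal.1 hx')))
  refine ⟨_, ⟨(supPrime_pLT hI).supIrred, (pLT_le_iff hI).2 ?_, gensOutside I, atomsOver I,
    atomsOver_nonempty hI, card_atomsOver_le hI, fun T hT => gensOutside_subset hT, rfl⟩, ?_⟩
  · exact Set.disjoint_left.1 ht (PFilter.mem_principal.2 le_rfl)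
  · rw [pLT_le_iff hI, not_not]
    exact hu (Ideal.mem_principal.2 le_rfl)

theorem finite_irredTermsBelow (t : FreePa n k) : (irredTermsBelow t).Finite := by
  refine (Set.finite_range fun q : Finset (Fin k) × Finset (Finset (Fin k)) =>
    pLT n q.1 q.2).subset ?_
  rintro p ⟨-, -, L, 𝒯, -, -, -, rfl⟩
  exact ⟨(L, 𝒯), rfl⟩

end FreePa

theorem mainTheorem2 (n : ℕ∞) (k : ℕ) (t : FreePa n k) :
    IsLUB (FreePa.irredTermsBelow t) t ∧
      IsLUB {p | Maximal (· ∈ FreePa.irredTermsBelow t) p} t := by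
  have h : IsLUB (FreePa.irredTermsBelow t) t := by
    refine ⟨fun p hp => hp.2.1, fun u hu => ?_⟩
    by_contra htu
    obtain ⟨p, hp, hpu⟩ := FreePa.exists_mem_irredTermsBelow_not_le htu
    exact hpu (hu hp)
  refine ⟨h, fun p hp => h.1 hp.prop, fun u hu => h.2 fun p hp => ?_⟩
  obtain ⟨q, hpq, hq⟩ := (FreePa.finite_irredTermsBelow t).exists_le_maximal hp
  exact hpq.trans (hu hq)
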